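/- Let $\gamma_2 = e-2$, and let $\varphi(q) = \dfrac{q\log q}{\log\log q}$ for $q \ge 3$ (natural logarithms; note that $\log\log q>0$ for $q\ge 3$). There exists a constant $c>0$ such that $$|q\gamma_2 - p| \ \ge\ \frac{c}{\varphi(q)}$$ for all integers $p$ and $q$ with $q\ge 3$. -/

import Mathlib

/-- The frequency `γ₂ = e - 2`. -/
noncomputable def gammaTwo : ℝ := Real.exp 1 - 2

/-- The function `φ(x) = x log x / log (log x)`; it is positive for real `x ≥ 3`. -/
noncomputable def phiFun (x : ℝ) : ℝ := x * Real.log x / Real.log (Real.log x)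

/-!
The proof compares `p / q` with the diagonal Padé approximants `P n / Q n` of `e`, namely
`1/1, 3/1, 19/7, 193/71, …`. Numerators and denominators satisfy
`x (n + 2) = (4 n + 6) x (n + 1) + x n`, and the remainders are Hermite's integrals
`Q n * e - P n = (-1) ^ n * I n`, where `I n = (1 / n!) ∫₀¹ (x (1 - x)) ^ n e ^ x dx > 0`
(`padeDen_mul_exp_sub_padeNum`). The integrals satisfy the matching recurrence
`I n = (4 n + 6) I (n + 1) + I (n + 2)`, found by integrating by parts, so two Casoratians are
constant: `Q (n + 1) * I n + Q n * I (n + 1) = 2`, which gives `I n ≤ 2 / Q (n + 1)`, and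
`P (n + 1) * Q n - P n * Q (n + 1) = ±2`, so that consecutive approximants are distinct.

Given `q`, let `m` be the index with `Q m < 4 q ≤ Q (m + 1)`. One of the two approximants with
index `m` and `m + 1` differs from `p / q`; for it, `q * P k - p * Q k` is a nonzero integer, while
`q * I k ≤ 1 / 2`, which forces `|q e - p| ≥ 1 / (2 Q (m + 1)) ≥ 1 / (32 (m + 1) q)`
(`exists_index_le_abs_mul_exp_sub`). Finally `m ^ m ≤ Q m < 4 q` yields
`(m + 1) log log q ≤ 7 log q` (`succ_mul_log_log_le`).
-/

/-! ### The Padé recurrence -/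

/-- The solution of `x (n + 2) = (4 n + 6) x (n + 1) + x n` with initial values `a` and `b`. -/
def padeSeq (a b : ℤ) : ℕ → ℤ
  | 0 => a
  | 1 => b
  | n + 2 => (4 * n + 6) * padeSeq a b (n + 1) + padeSeq a b n

/-- The denominators `1, 1, 7, 71, …` of the diagonal Padé approximants of `e`. -/
def padeDen : ℕ → ℤ := padeSeq 1 1

/-- The numerators `1, 3, 19, 193, …` of the diagonal Padé approximants of `e`. -/
def padeNum : ℕ → ℤ := padeSeq 1 3

lemma padeDen_zero : padeDen 0 = 1 := rfl

lemma padeDen_one : padeDen 1 = 1 := rfl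

lemma padeDen_add_two (n : ℕ) :
    padeDen (n + 2) = (4 * n + 6) * padeDen (n + 1) + padeDen n := rfl

lemma padeNum_zero : padeNum 0 = 1 := rfl

lemma padeNum_one : padeNum 1 = 3 := rfl

lemma padeNum_add_two (n : ℕ) :
    padeNum (n + 2) = (4 * n + 6) * padeNum (n + 1) + padeNum n := rfl

lemma padeDen_pos_and_le_succ (n : ℕ) : 0 < padeDen n ∧ padeDen n ≤ padeDen (n + 1) := by
  induction n with
  | zero => simp [padeDen_zero, padeDen_one]
  | succ n ih =>
    have h := padeDen_add_two n
    have hpos : 0 < padeDen (n + 1) := ih.1.trans_le ih.2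
    refine ⟨hpos, ?_⟩
    have : 0 ≤ (n : ℤ) * padeDen (n + 1) := by positivity
    linarith [ih.1]

lemma padeDen_pos (n : ℕ) : 0 < padeDen n := (padeDen_pos_and_le_succ n).1

lemma padeDen_le_succ (n : ℕ) : padeDen n ≤ padeDen (n + 1) := (padeDen_pos_and_le_succ n).2

lemma padeDen_succ_le (n : ℕ) : padeDen (n + 1) ≤ 4 * (n + 1) * padeDen n := by
  cases n with
  | zero => simp [padeDen_zero, padeDen_one]
  | succ n =>
    rw [padeDen_add_two]
    push_cast
    linarith [padeDen_le_succ n, padeDen_pos n]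

lemma four_mul_add_two_mul_padeDen_le {n : ℕ} (hn : 1 ≤ n) :
    (4 * n + 2) * padeDen n ≤ padeDen (n + 1) := by
  obtain ⟨n, rfl⟩ := Nat.exists_eq_add_of_le' hn
  rw [padeDen_add_two]
  push_cast
  linarith [padeDen_pos n]

/-- Superexponential growth of the denominators; the induction step rests on
`(1 + 1 / n) ^ n ≤ e ≤ 3` and `3 (n + 1) ≤ 4 n + 2`. -/
lemma natCast_pow_self_le_padeDen (n : ℕ) : (n : ℝ) ^ n ≤ padeDen n := by
  rcases Nat.eq_zero_or_pos n with rfl | hn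
  · simp [padeDen_zero]
  induction n, hn using Nat.le_induction with
  | base => simp [padeDen_one]
  | succ n hn ih =>
    have hn' : (1 : ℝ) ≤ n := by exact_mod_cast hn
    have hrec : (4 * n + 2) * (padeDen n : ℝ) ≤ padeDen (n + 1) := by
      exact_mod_cast four_mul_add_two_mul_padeDen_le hn
    have hexp : (1 + 1 / (n : ℝ)) ^ n ≤ 3 := by
      calc (1 + 1 / (n : ℝ)) ^ n ≤ Real.exp (1 / n) ^ n := by
            gcongr
            linarith [Real.add_one_le_exp (1 / (n : ℝ))]
        _ = Real.exp 1 := by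
            rw [← Real.exp_nat_mul]
            congr 1
            field_simp
        _ ≤ 3 := by linarith [Real.exp_one_lt_d9]
    calc ((n + 1 : ℕ) : ℝ) ^ (n + 1)
        = (n + 1) * ((1 + 1 / (n : ℝ)) ^ n * n ^ n) := by
          rw [← mul_pow, add_mul 1, one_div_mul_cancel (by positivity)]
          push_cast
          ring
      _ ≤ (n + 1) * (3 * n ^ n) := by gcongr
      _ ≤ (4 * n + 2) * n ^ n := by
          rw [← mul_assoc]
          gcongr
          linarith
      _ ≤ (4 * n + 2) * padeDen n := by gcongr
      _ ≤ padeDen (n + 1) := hrec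

lemma padeNum_succ_mul_padeDen_sub (n : ℕ) :
    padeNum (n + 1) * padeDen n - padeNum n * padeDen (n + 1) = 2 * (-1) ^ n := by
  induction n with
  | zero => simp [padeNum_zero, padeNum_one, padeDen_zero, padeDen_one]
  | succ n ih =>
    rw [padeNum_add_two, padeDen_add_two, pow_succ]
    linear_combination -ih

/-! ### Hermite's integrals -/

/-- Hermite's integral `(1 / n!) ∫₀¹ (x (1 - x)) ^ n e ^ x dx`, the absolute value of the
remainder `Q n * e - P n`. -/
noncomputable def hermiteIntegral (n : ℕ) : ℝ :=
  (∫ x in (0 : ℝ)..1, (x * (1 - x)) ^ n * Real.exp x) / n.factorial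

lemma hermiteIntegral_pos (n : ℕ) : 0 < hermiteIntegral n := by
  refine div_pos ?_ (by positivity)
  refine intervalIntegral.intervalIntegral_pos_of_pos_on
    (Continuous.intervalIntegrable (by fun_prop) _ _) (fun x hx => ?_) one_pos
  have : 0 < x * (1 - x) := mul_pos hx.1 (by linarith [hx.2])
  positivity

lemma hermiteIntegral_zero : hermiteIntegral 0 = Real.exp 1 - 1 := by
  simp [hermiteIntegral]

lemma hermiteIntegral_one : hermiteIntegral 1 = 3 - Real.exp 1 := by
  have hderiv (x : ℝ) : HasDerivAt (fun x : ℝ => (-x ^ 2 + 3 * x - 3) * Real.exp x)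
      ((x * (1 - x)) ^ 1 * Real.exp x) x := by
    have h := ((((hasDerivAt_id x).pow 2).neg.add ((hasDerivAt_id x).const_mul 3)).sub_const
      3).mul (Real.hasDerivAt_exp x)
    refine h.congr_deriv ?_
    simp
    ring
  rw [hermiteIntegral, intervalIntegral.integral_eq_sub_of_hasDerivAt (fun x _ => hderiv x)
    (Continuous.intervalIntegrable (by fun_prop) _ _)]
  simp
  ring

/-- The recurrence of the Hermite integrals. With `u = x (1 - x)`, the primitive
`(u ^ (n + 1) * u' - u ^ (n + 2) / (n + 2)) * e ^ x` vanishes at both ends of `[0, 1]`, and its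
derivative is computed from `u' ^ 2 = 1 - 4 u`. -/
lemma hermiteIntegral_eq (n : ℕ) :
    hermiteIntegral n = (4 * n + 6) * hermiteIntegral (n + 1) + hermiteIntegral (n + 2) := by
  have hn₂ : (n : ℝ) + 2 ≠ 0 := by positivity
  have hderiv (x : ℝ) : HasDerivAt
      (fun x : ℝ => ((x * (1 - x)) ^ (n + 1) * (1 - 2 * x)
        - (x * (1 - x)) ^ (n + 2) / (n + 2)) * Real.exp x)
      ((n + 1) * ((x * (1 - x)) ^ n * Real.exp x)
        - (4 * n + 6) * ((x * (1 - x)) ^ (n + 1) * Real.exp x)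
        - 1 / (n + 2) * ((x * (1 - x)) ^ (n + 2) * Real.exp x)) x := by
    have hu : HasDerivAt (fun x : ℝ => x * (1 - x)) (1 - 2 * x) x := by
      have h := (hasDerivAt_id x).mul ((hasDerivAt_id x).const_sub 1)
      refine h.congr_deriv ?_
      simp
      ring
    have hu' : HasDerivAt (fun x : ℝ => 1 - 2 * x) (-2) x := by
      simpa using ((hasDerivAt_id x).const_mul 2).const_sub 1
    have h := (((hu.pow (n + 1)).mul hu').sub ((hu.pow (n + 2)).div_const (n + 2 : ℝ))).mul
      (Real.hasDerivAt_exp x)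
    refine h.congr_deriv ?_
    simp only [Pi.mul_apply, Pi.sub_apply, Pi.pow_apply, Nat.add_sub_cancel,
      show n + 2 - 1 = n + 1 by omega]
    push_cast
    field_simp
    ring
  have hint (k : ℕ) : IntervalIntegrable (fun x : ℝ => (x * (1 - x)) ^ k * Real.exp x)
      MeasureTheory.volume 0 1 := Continuous.intervalIntegrable (by fun_prop) _ _
  have h := intervalIntegral.integral_eq_sub_of_hasDerivAt (fun x _ => hderiv x)
    ((((hint n).const_mul _).sub ((hint (n + 1)).const_mul _)).sub ((hint (n + 2)).const_mul _))
  rw [intervalIntegral.integral_sub (((hint n).const_mul _).sub ((hint (n + 1)).const_mul _))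
      ((hint (n + 2)).const_mul _),
    intervalIntegral.integral_sub ((hint n).const_mul _) ((hint (n + 1)).const_mul _),
    intervalIntegral.integral_const_mul, intervalIntegral.integral_const_mul,
    intervalIntegral.integral_const_mul] at h
  simp only [sub_self, mul_zero, zero_mul, zero_pow (Nat.succ_ne_zero _), zero_div] at h
  have hfac : (n.factorial : ℝ) ≠ 0 := by positivity
  simp only [hermiteIntegral, Nat.factorial_succ]
  push_cast
  rw [show (n : ℝ) + 1 + 1 = n + 2 by ring]
  field_simp at h ⊢
  linear_combination h

lemma hermiteIntegral_succ_le (n : ℕ) : hermiteIntegral (n + 1) ≤ hermiteIntegral n := by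
  have h : 0 ≤ (4 * n + 5) * hermiteIntegral (n + 1) :=
    mul_nonneg (by positivity) (hermiteIntegral_pos _).le
  linarith [hermiteIntegral_eq n, hermiteIntegral_pos (n + 2)]

/-! ### The Padé approximants of `e` -/

lemma padeDen_mul_exp_sub_padeNum (n : ℕ) :
    padeDen n * Real.exp 1 - padeNum n = (-1) ^ n * hermiteIntegral n := by
  induction n using Nat.twoStepInduction with
  | zero => simp [padeNum_zero, padeDen_zero, hermiteIntegral_zero]
  | one => simp [padeNum_one, padeDen_one, hermiteIntegral_one]
  | more n ih₀ ih₁ =>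
    rw [padeNum_add_two, padeDen_add_two]
    push_cast
    rw [pow_succ] at ih₁
    rw [pow_add, neg_one_sq]
    linear_combination (4 * n + 6) * ih₁ + ih₀ + (-1) ^ n * hermiteIntegral_eq n

lemma padeDen_succ_mul_hermiteIntegral_add (n : ℕ) :
    padeDen (n + 1) * hermiteIntegral n + padeDen n * hermiteIntegral (n + 1) = 2 := by
  induction n with
  | zero =>
    simp only [zero_add, padeDen_zero, padeDen_one, hermiteIntegral_zero, hermiteIntegral_one]
    push_cast
    ring
  | succ n ih =>
    rw [padeDen_add_two]
    push_cast
    linear_combination ih - padeDen (n + 1) * hermiteIntegral_eq n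

lemma padeDen_succ_mul_hermiteIntegral_le (n : ℕ) :
    padeDen (n + 1) * hermiteIntegral n ≤ 2 := by
  have h : 0 ≤ (padeDen n : ℝ) * hermiteIntegral (n + 1) :=
    mul_nonneg (by exact_mod_cast (padeDen_pos n).le) (hermiteIntegral_pos _).le
  linarith [padeDen_succ_mul_hermiteIntegral_add n]

/-- Consecutive approximants are distinct, so at most one of them equals `p / q`. -/
lemma padeNum_ne_or_padeNum_succ_ne (n : ℕ) (p : ℤ) {q : ℤ} (hq : q ≠ 0) :
    q * padeNum n - p * padeDen n ≠ 0 ∨ q * padeNum (n + 1) - p * padeDen (n + 1) ≠ 0 := by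
  by_contra! h
  have hzero : q * (2 * (-1) ^ n) = 0 := by
    linear_combination (-q) * padeNum_succ_mul_padeDen_sub n + padeDen n * h.2
      - padeDen (n + 1) * h.1
  simp [hq] at hzero

/-- An approximant other than `p / q` whose remainder is at most `1 / (2 q)` keeps `q e` away from
`p`: the nonzero integer `q * P n - p * Q n` equals `Q n * (q e - p) - q * (Q n * e - P n)`. -/
lemma half_le_padeDen_mul_abs {n : ℕ} {p q : ℤ} (hq : 0 < q)
    (hne : q * padeNum n - p * padeDen n ≠ 0) (hsmall : q * hermiteIntegral n ≤ 1 / 2) :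
    1 / 2 ≤ padeDen n * |q * Real.exp 1 - p| := by
  have hone : (1 : ℝ) ≤ |(q * padeNum n - p * padeDen n : ℝ)| := by
    exact_mod_cast Int.one_le_abs hne
  have hq' : (0 : ℝ) < q := by exact_mod_cast hq
  have hQ : (0 : ℝ) < padeDen n := by exact_mod_cast padeDen_pos n
  have heq : (q * padeNum n - p * padeDen n : ℝ)
      = padeDen n * (q * Real.exp 1 - p) - q * ((-1) ^ n * hermiteIntegral n) := by
    rw [← padeDen_mul_exp_sub_padeNum]
    ring
  have habs : |(q : ℝ) * ((-1) ^ n * hermiteIntegral n)| = q * hermiteIntegral n := by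
    rw [abs_mul, abs_mul, abs_neg_one_pow, one_mul, abs_of_pos hq',
      abs_of_pos (hermiteIntegral_pos n)]
  have htri := abs_sub ((padeDen n : ℝ) * (q * Real.exp 1 - p))
    (q * ((-1) ^ n * hermiteIntegral n))
  rw [habs, ← heq, abs_mul, abs_of_pos hQ] at htri
  linarith

/-! ### The lower bound -/

lemma exists_padeDen_lt_le {q : ℤ} (hq : 1 ≤ q) :
    ∃ m, padeDen m < 4 * q ∧ 4 * q ≤ padeDen (m + 1) := by
  have hex : ∃ n, 4 * q ≤ padeDen n := by
    obtain ⟨N, hN⟩ : ∃ N : ℕ, 4 * q = N := Int.eq_ofNat_of_zero_le (by linarith)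
    have hN0 : N ≠ 0 := by omega
    refine ⟨N, ?_⟩
    have hpow : (N : ℝ) ≤ (N : ℝ) ^ N :=
      le_self_pow₀ (by exact_mod_cast Nat.one_le_iff_ne_zero.mpr hN0) hN0
    have h := hpow.trans (natCast_pow_self_le_padeDen N)
    rw [hN]
    exact_mod_cast h
  classical
  obtain ⟨m, hm⟩ : ∃ m, Nat.find hex = m + 1 := by
    refine Nat.exists_eq_succ_of_ne_zero fun h => ?_
    have h0 := Nat.find_spec hex
    rw [h, padeDen_zero] at h0
    linarith
  exact ⟨m, not_le.mp (Nat.find_min hex (by omega)), hm ▸ Nat.find_spec hex⟩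

/-- The lower bound in terms of the index of the approximant; the index satisfies
`m ^ m < 4 q`. -/
lemma exists_index_le_abs_mul_exp_sub (p : ℤ) {q : ℤ} (hq : 1 ≤ q) :
    ∃ m : ℕ, (m : ℝ) ^ m < 4 * q ∧ 1 ≤ 32 * (m + 1) * q * |q * Real.exp 1 - p| := by
  obtain ⟨m, hlt, hle⟩ := exists_padeDen_lt_le hq
  have hlt' : (padeDen m : ℝ) < 4 * q := by exact_mod_cast hlt
  have hle' : 4 * (q : ℝ) ≤ padeDen (m + 1) := by exact_mod_cast hle
  have hq' : (0 : ℝ) < q := by exact_mod_cast hq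
  refine ⟨m, (natCast_pow_self_le_padeDen m).trans_lt hlt', ?_⟩
  have hsmall : q * hermiteIntegral m ≤ 1 / 2 := by
    have h := mul_le_mul_of_nonneg_right hle' (hermiteIntegral_pos m).le
    linarith [padeDen_succ_mul_hermiteIntegral_le m]
  have hsmall' : q * hermiteIntegral (m + 1) ≤ 1 / 2 :=
    (mul_le_mul_of_nonneg_left (hermiteIntegral_succ_le m) hq'.le).trans hsmall
  have hmono : (padeDen m : ℝ) ≤ padeDen (m + 1) := by exact_mod_cast padeDen_le_succ m
  have hhalf : 1 / 2 ≤ (padeDen (m + 1) : ℝ) * |q * Real.exp 1 - p| := by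
    rcases padeNum_ne_or_padeNum_succ_ne m p (q := q) (by omega) with hne | hne
    · exact (half_le_padeDen_mul_abs hq hne hsmall).trans (by gcongr)
    · exact half_le_padeDen_mul_abs hq hne hsmall'
  have hsucc : (padeDen (m + 1) : ℝ) ≤ 4 * (m + 1) * padeDen m := by
    exact_mod_cast padeDen_succ_le m
  have hQ : (padeDen (m + 1) : ℝ) ≤ 4 * (m + 1) * (4 * q) := hsucc.trans (by gcongr)
  linarith [mul_le_mul_of_nonneg_right hQ (abs_nonneg (q * Real.exp 1 - p))]

lemma one_lt_log_of_three_le {x : ℝ} (hx : 3 ≤ x) : 1 < Real.log x := by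
  rw [Real.lt_log_iff_exp_lt (by linarith)]
  linarith [Real.exp_one_lt_d9]

/-- Inverting `m ^ m < 4 x`: either `m` is below `√(log x)`, and `log log x ≤ 2 √(log x)`
suffices, or `log m ≥ (log log x) / 2`. -/
lemma succ_mul_log_log_le {m : ℕ} {x : ℝ} (hx : 3 ≤ x) (hm : (m : ℝ) ^ m < 4 * x) :
    (m + 1) * Real.log (Real.log x) ≤ 7 * Real.log x := by
  set L := Real.log x with hL
  have hL1 : 1 < L := one_lt_log_of_three_le hx
  have hs : 1 ≤ √L := Real.one_le_sqrt.mpr hL1.le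
  have hsq : √L * √L = L := Real.mul_self_sqrt (by linarith)
  have hlog : Real.log √L = Real.log L / 2 := Real.log_sqrt (by linarith)
  have hlog_le : Real.log L ≤ L := Real.log_le_self (by linarith)
  suffices h : m * Real.log L ≤ 6 * L by linarith
  rcases le_total (m : ℝ) √L with hmle | hmge
  · have h1 : Real.log L ≤ 2 * √L := by
      linarith [Real.log_le_self (Real.sqrt_nonneg L)]
    calc (m : ℝ) * Real.log L ≤ √L * (2 * √L) :=
          mul_le_mul hmle h1 (Real.log_nonneg hL1.le) (Real.sqrt_nonneg _)
      _ = 2 * L := by linear_combination 2 * hsq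
      _ ≤ 6 * L := by linarith
  · have hm0 : (0 : ℝ) < m := by linarith
    have h1 : Real.log L / 2 ≤ Real.log m := hlog ▸ Real.log_le_log (by linarith) hmge
    have h2 : m * Real.log m ≤ Real.log 4 + L := by
      rw [← Real.log_pow, hL, ← Real.log_mul (by norm_num) (by linarith)]
      exact Real.log_le_log (by positivity) hm.le
    have h3 : Real.log 4 ≤ 2 * L := by
      rw [show (4 : ℝ) = 2 ^ 2 by norm_num, Real.log_pow]
      push_cast
      linarith [Real.log_two_lt_d9]
    linarith [mul_le_mul_of_nonneg_left h1 hm0.le]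

theorem mainTheorem6 :
    ∃ c : ℝ, 0 < c ∧ ∀ p q : ℤ, 3 ≤ q →
      |(q : ℝ) * gammaTwo - (p : ℝ)| ≥ c / phiFun (q : ℝ) := by
  -- `224 = 32 * 7` combines the constants of the two bounds on the index `m`.
  refine ⟨1 / 224, by norm_num, fun p q hq => ?_⟩
  have hq3 : (3 : ℝ) ≤ q := by exact_mod_cast hq
  obtain ⟨m, hm, hbound⟩ := exists_index_le_abs_mul_exp_sub (p + 2 * q) (q := q) (by omega)
  have hL1 := one_lt_log_of_three_le hq3
  have hLL : 0 < Real.log (Real.log q) := Real.log_pos hL1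
  have hindex := succ_mul_log_log_le hq3 hm
  have heq : (q : ℝ) * gammaTwo - p = q * Real.exp 1 - (p + 2 * q : ℤ) := by
    rw [gammaTwo]
    push_cast
    ring
  rw [heq]
  set A := |(q : ℝ) * Real.exp 1 - (p + 2 * q : ℤ)|
  have hA0 : 0 ≤ A := abs_nonneg _
  have hphi : 0 < phiFun q := by
    unfold phiFun
    positivity
  rw [ge_iff_le, div_le_iff₀ hphi, phiFun, mul_div_assoc', le_div_iff₀ hLL]
  have h1 := mul_le_mul_of_nonneg_right hbound hLL.le
  have h2 := mul_le_mul_of_nonneg_left hindex (show 0 ≤ 32 * (q : ℝ) * A by positivity)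
  linarith
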